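/- For Hilbert spaces $\mathcal H,\mathcal K$ (complex), write $A\ge 0$ for a bounded operator $A$ with $\langle Ax,x\rangle\ge 0$ for all $x$ (such $A$ is called positive), and $A\le B$ for $B-A\ge 0$. For $0\le\alpha\le 1$ and positive operators $A,B$ with $A$ invertible, let $$A\sharp_\alpha B=A^{1/2}\left(A^{-1/2}BA^{-1/2}\right)^{\alpha}A^{1/2}\qquad(\text{with } T^0=I),$$ and for arbitrary positive operators $A,B$ let $A\sharp_\alpha B=\lim_{\varepsilon\downarrow 0}\,(A+\varepsilon I)\sharp_\alpha(B+\varepsilon I)$ in the strong operator topology; this limit exists, and it agrees with the formula if $A$ is invertible. **Theorem.** Let $0\le\alpha,\beta\le 1$. 1. Let $\Phi:\mathcal B(\mathcal H)\to\mathcal B(\mathcal K)$ be a positive linear map, that is, $\Phi(X)\ge 0$ whenever $X\ge 0$. Then for all positive operators $A,B\in\mathcal B(\mathcal H)$, $$\Phi(A\sharp_\alpha B)\le \Phi\big((A\sharp_\alpha B)\sharp_\beta A\big)\,\sharp_\alpha\,\Phi\big((A\sharp_\alpha B)\sharp_\beta B\big)\le \Phi(A)\,\sharp_\alpha\,\Phi(B).$$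 2. In particular, for all positive operators $A_1,\dots,A_m,B_1,\dots,B_m\in\mathcal B(\mathcal H)$, $$\sum_{j=1}^m A_j\sharp_\alpha B_j\le\Big(\sum_{j=1}^m (A_j\sharp_\alpha B_j)\sharp_\beta A_j\Big)\sharp_\alpha\Big(\sum_{j=1}^m (A_j\sharp_\alpha B_j)\sharp_\beta B_j\Big)\le\Big(\sum_{j=1}^m A_j\Big)\sharp_\alpha\Big(\sum_{j=1}^m B_j\Big).$$ -/

import Mathlib

open Filter Topology

noncomputable section

/-- The weighted geometric mean by its formula
`A ♯_α B = A^{1/2} (A^{-1/2} B A^{-1/2})^α A^{1/2}`, meaningful for an invertible positive `A`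
and a positive `B`. The powers are those of the continuous functional calculus; `T ^ 0 = 1`. -/
def geomMeanFormula {H : Type*} [NormedAddCommGroup H] [InnerProductSpace ℂ H] [CompleteSpace H]
    (α : ℝ) (A B : H →L[ℂ] H) : H →L[ℂ] H :=
  A ^ (1 / 2 : ℝ) * (A ^ (-(1 / 2) : ℝ) * B * A ^ (-(1 / 2) : ℝ)) ^ α * A ^ (1 / 2 : ℝ)

/-- `T` is the weighted geometric mean of the positive (possibly non-invertible) operators
`A` and `B`: the limit in the strong operator topology, as `ε ↓ 0`, of
`(A + ε I) ♯_α (B + ε I)`. -/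
def IsGeomMean {H : Type*} [NormedAddCommGroup H] [InnerProductSpace ℂ H] [CompleteSpace H]
    (α : ℝ) (A B T : H →L[ℂ] H) : Prop :=
  ∀ x : H, Tendsto
    (fun ε : ℝ => geomMeanFormula α (A + (ε : ℂ) • 1) (B + (ε : ℂ) • 1) x) (𝓝[>] 0) (𝓝 (T x))

open Classical in
/-- The weighted geometric mean `A ♯_α B` of positive operators (`0` if the limit defining it
does not exist). -/
def geomMean {H : Type*} [NormedAddCommGroup H] [InnerProductSpace ℂ H] [CompleteSpace H]
    (α : ℝ) (A B : H →L[ℂ] H) : H →L[ℂ] H :=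
  if h : ∃ T : H →L[ℂ] H, IsGeomMean α A B T then h.choose else 0

theorem IsGeomMean.geomMean_eq {H : Type*} [NormedAddCommGroup H] [InnerProductSpace ℂ H]
    [CompleteSpace H] {α : ℝ} {A B T : H →L[ℂ] H} (h : IsGeomMean α A B T) :
    geomMean α A B = T := by
  have hex : ∃ T : H →L[ℂ] H, IsGeomMean α A B T := ⟨T, h⟩
  rw [geomMean, dif_pos hex]
  ext x
  exact tendsto_nhds_unique (hex.choose_spec x) (h x)

/-- For an invertible positive `A` the mean is given by the formula. -/
theorem geomMean_eq_formula {H : Type*} [NormedAddCommGroup H] [InnerProductSpace ℂ H]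
    [CompleteSpace H] {α : ℝ} (hα : 0 ≤ α) {A B : H →L[ℂ] H} (hA : IsStrictlyPositive A)
    (hB : 0 ≤ B) : geomMean α A B = geomMeanFormula α A B := by
  apply IsGeomMean.geomMean_eq
  have hε : ∀ ε : ℝ, 0 ≤ ε → (0 : H →L[ℂ] H) ≤ (ε : ℂ) • 1 := fun ε h => by
    rw [Complex.coe_smul]
    exact smul_nonneg h zero_le_one
  have key : ∀ C : H →L[ℂ] H, Tendsto (fun ε : ℝ => C + (ε : ℂ) • (1 : H →L[ℂ] H)) (𝓝[>] 0) (𝓝 C) := by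
    intro C
    have : Continuous (fun ε : ℝ => C + (ε : ℂ) • (1 : H →L[ℂ] H)) := by fun_prop
    have h := this.tendsto 0
    simp only [Complex.ofReal_zero, zero_smul, add_zero] at h
    exact h.mono_left nhdsWithin_le_nhds
  have hev : ∀ᶠ ε : ℝ in 𝓝[>] 0, (0 : ℝ) ≤ ε := by
    filter_upwards [self_mem_nhdsWithin] with ε h using le_of_lt h
  have hAs : ∀ᶠ ε : ℝ in 𝓝[>] 0, IsStrictlyPositive (A + (ε : ℂ) • (1 : H →L[ℂ] H)) := by
    filter_upwards [hev] with ε h using hA.add_nonneg (hε ε h)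
  have hpow : ∀ r : ℝ, Tendsto (fun ε : ℝ => (A + (ε : ℂ) • (1 : H →L[ℂ] H)) ^ r) (𝓝[>] 0)
      (𝓝 (A ^ r)) := fun r =>
    (CFC.continuousOn_rpow r A hA).tendsto.comp
      (tendsto_nhdsWithin_iff.2 ⟨key A, hAs⟩)
  have hself : ∀ C : H →L[ℂ] H, ∀ r : ℝ, IsSelfAdjoint (C ^ r) := fun C r =>
    IsSelfAdjoint.of_nonneg CFC.rpow_nonneg
  have hmid0 : ∀ C D : H →L[ℂ] H, 0 ≤ D → ∀ r : ℝ, 0 ≤ C ^ r * D * C ^ r := fun C D hD r => by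
    exact (hself C r).conjugate_nonneg hD
  have hmid := ((hpow (-(1 / 2))).mul (key B)).mul (hpow (-(1 / 2)))
  have hmidpow : Tendsto (fun ε : ℝ => ((A + (ε : ℂ) • (1 : H →L[ℂ] H)) ^ (-(1 / 2) : ℝ) *
      (B + (ε : ℂ) • 1) * (A + (ε : ℂ) • (1 : H →L[ℂ] H)) ^ (-(1 / 2) : ℝ)) ^ α) (𝓝[>] 0)
      (𝓝 ((A ^ (-(1 / 2) : ℝ) * B * A ^ (-(1 / 2) : ℝ)) ^ α)) := by
    have hcont : ContinuousOn (fun a : H →L[ℂ] H => a ^ α) {a | 0 ≤ a} := by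
      rcases hα.eq_or_lt with rfl | hpos
      · exact continuousOn_const.congr CFC.rpow_zero_eqOn
      · have := CFC.continuousOn_nnrpow (A := H →L[ℂ] H) (⟨α, hα⟩ : NNReal)
        refine this.congr fun a _ => ?_
        exact (CFC.nnrpow_eq_rpow (x := (⟨α, hα⟩ : NNReal)) hpos).symm
    refine (hcont _ (hmid0 A B hB _)).tendsto.comp (tendsto_nhdsWithin_iff.2 ⟨hmid, ?_⟩)
    filter_upwards [hev] with ε h using hmid0 _ _ (add_nonneg hB (hε ε h)) _
  have hall := ((hpow (1 / 2)).mul hmidpow).mul (hpow (1 / 2))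
  intro x
  exact ((ContinuousLinearMap.apply ℂ H x).continuous.tendsto _).comp hall

end

/-!
The theorem rests on Ando's inequality `∑ Φ_j(A_j ♯_α B_j) ≤ (∑ Φ_j(A_j)) ♯_α (∑ Φ_j(B_j))` for
positive linear maps `Φ_j` (`sum_map_geomMean_le`) and on the identity
`(M ♯_β A) ♯_α (M ♯_β B) = M` for `M = A ♯_α B` (`geomMean_refine_le`, `le_geomMean_refine`). The first
inequality of the theorem is Ando's inequality for the operators `M_j ♯_β A_j`, `M_j ♯_β B_j`, whose
means are the `M_j`. For the second, let `C = ∑ Φ_j(A_j)`, `D = ∑ Φ_j(B_j)` and `N = C ♯_α D`. Ando's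
inequality gives `∑ Φ_j(M_j) ≤ N`, then `∑ Φ_j(M_j ♯_β A_j) ≤ N ♯_β C` and
`∑ Φ_j(M_j ♯_β B_j) ≤ N ♯_β D`, and the mean of these two upper bounds is `N` again. Working with finite
families of maps treats a single map and sums of means at once (`sum_map_geomMean_refine`).

For invertible operators Ando's inequality is the operator Jensen inequality
`∑ Φ_j(Z_j ^ α) ≤ (∑ Φ_j(Z_j)) ^ α` (`sum_map_rpow_le`) after a congruence. By the integral
representation of `u ↦ u ^ α`, the latter reduces to the functions `u ↦ t u / (t + u)`. Their values at
positive operators are given by the variational formula `min_y (t ‖x - y‖² + ⟪Z y, y⟫)`, and positive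
maps respect it (`reApplyInnerSelf_map_cfc_le`). The identity for `M` says that `s ↦ A ♯_s B` is a
geodesic (`geomMeanFormula_geomMeanFormula`).

To pass to non-invertible operators, the means of `A + ε` and `B + ε` decrease as `ε ↓ 0`, so they
converge strongly by Vigier's theorem. The maps `Φ_j` are not assumed to be strongly continuous, but
`Φ_j(1)` is bounded, which together with monotonicity is enough for Ando's inequality. The lower
bound in the identity for `M` needs upper semicontinuity of the mean under bounded strong convergence
(`le_geomMean_of_boundedStrongTendsto`), a consequence of the strong continuity of the functional
calculus on bounded sets.
-/

/-! ### Positive operators and their quadratic forms -/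

section Jensen

variable {H : Type*} [NormedAddCommGroup H] [InnerProductSpace ℂ H] [CompleteSpace H]
variable {K : Type*} [NormedAddCommGroup K] [InnerProductSpace ℂ K] [CompleteSpace K]

omit [CompleteSpace H] in
theorem reApplyInnerSelf_mono {S T : H →L[ℂ] H} (h : S ≤ T) (x : H) :
    S.reApplyInnerSelf x ≤ T.reApplyInnerSelf x := by
  have h1 := ((ContinuousLinearMap.le_def S T).1 h).2 x
  simp only [ContinuousLinearMap.reApplyInnerSelf_apply, sub_apply,
    inner_sub_left, map_sub] at h1 ⊢
  linarith

theorem le_of_reApplyInnerSelf_le {S T : H →L[ℂ] H} (hS : IsSelfAdjoint S) (hT : IsSelfAdjoint T)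
    (h : ∀ x, S.reApplyInnerSelf x ≤ T.reApplyInnerSelf x) : S ≤ T := by
  rw [ContinuousLinearMap.le_def, ContinuousLinearMap.isPositive_def']
  refine ⟨hT.sub hS, fun x => ?_⟩
  have h1 := h x
  simp only [ContinuousLinearMap.reApplyInnerSelf_apply, sub_apply,
    inner_sub_left, map_sub] at h1 ⊢
  linarith

omit [CompleteSpace H] in
theorem reApplyInnerSelf_nonneg {T : H →L[ℂ] H} (h : 0 ≤ T) (x : H) :
    0 ≤ T.reApplyInnerSelf x := by
  simpa [ContinuousLinearMap.reApplyInnerSelf_apply] using reApplyInnerSelf_mono h x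

/-! ### The operator Jensen inequality for positive maps -/

/-- A positive element `Z` is approximated by a "discrete spectral measure": there are positive `E k`
with sum `1` and points `l k ≥ 0` such that `∑ l k • E k = Z` exactly and `f(Z)` is at most
`∑ f (l k) • E k` up to `ε`. The `E k` are the Bernstein polynomials of `Z`, which reproduce constant
and linear functions exactly and approximate continuous ones uniformly. They stand in for spectral
projections, which the C⋆-algebra need not contain. -/
theorem exists_bernstein_partition {A : Type*} [CStarAlgebra A] [PartialOrder A] [StarOrderedRing A]
    {Z : A} (hZ : 0 ≤ Z) {f : ℝ → ℝ} (hf : ContinuousOn f (Set.Ici 0)) {ε : ℝ} (hε : 0 < ε) :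
    ∃ (n : ℕ) (E : Fin (n + 1) → A) (l : Fin (n + 1) → ℝ),
      (∀ k, 0 ≤ E k) ∧ (∀ k, 0 ≤ l k) ∧ ∑ k, E k = 1 ∧ ∑ k, l k • E k = Z ∧
        cfc f Z ≤ ∑ k, f (l k) • E k + ε • 1 := by
  -- rescaled to the unit interval; `b` is kept positive also for `Z = 0`
  set b : ℝ := ‖Z‖ + 1
  have hb0 : 0 < b := by positivity
  have hsa : IsSelfAdjoint Z := .of_nonneg hZ
  have hspec : ∀ x ∈ spectrum ℝ Z, x / b ∈ unitInterval := fun x hx => by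
    have : Nontrivial A := by
      by_contra h
      rw [not_nontrivial_iff_subsingleton] at h
      simp [spectrum.of_subsingleton] at hx
    have h0 : 0 ≤ x := spectrum_nonneg_of_nonneg hZ hx
    have h1 : x ≤ ‖Z‖ := (le_abs_self x).trans (spectrum.norm_le_norm_of_mem hx)
    exact ⟨by positivity, (div_le_one hb0).2 (by linarith)⟩
  let F : C(unitInterval, ℝ) := ⟨fun u => f (b * u), by
    rw [← continuousOn_univ]
    exact hf.comp (by fun_prop) fun u _ => mul_nonneg hb0.le u.2.1⟩
  have hlim := bernsteinApproximation_uniform F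
  obtain ⟨n, hn, hn0⟩ := (((Metric.tendsto_nhds.1 hlim) ε hε).and (eventually_ne_atTop 0)).exists
  let e : Fin (n + 1) → ℝ → ℝ := fun k x => (bernsteinPolynomial ℝ n k).eval (x / b)
  have he : ∀ k x (hx : x / b ∈ unitInterval), e k x = bernstein n k ⟨x / b, hx⟩ := fun k x hx => by
    simp [e, bernstein]
  have hec : ∀ k, Continuous (e k) := fun k => by fun_prop
  refine ⟨n, fun k => cfc (e k) Z, fun k => b * (k / n), fun k => ?_, fun k => by positivity,
    ?_, ?_, ?_⟩
  · refine cfc_nonneg fun x hx => ?_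
    rw [he k x (hspec x hx)]
    exact bernstein_nonneg
  · rw [← cfc_sum_univ e Z (fun i => (hec i).continuousOn)]
    conv_rhs => rw [← cfc_const_one ℝ Z]
    refine cfc_congr fun x hx => ?_
    rw [Finset.sum_apply]
    simp only [he _ x (hspec x hx)]
    exact bernstein.probability n _
  · have h1 : ∀ k : Fin (n + 1), (b * ((k : ℝ) / n)) • cfc (e k) Z =
        cfc (fun x => (b * ((k : ℝ) / n)) * e k x) Z := fun k => by
      rw [← cfc_const_mul _ _ _ (hec k).continuousOn]
    simp only [h1]
    rw [← cfc_sum_univ _ Z (fun i => by have := hec i; fun_prop)]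
    conv_rhs => rw [← cfc_id' ℝ Z]
    refine cfc_congr fun x hx => ?_
    have h2 := congrArg (Polynomial.eval (x / b)) (bernsteinPolynomial.sum_smul ℝ n)
    simp only [Finset.sum_range, Polynomial.eval_finsetSum, nsmul_eq_mul,
      Polynomial.eval_mul, Polynomial.eval_natCast, Polynomial.eval_X] at h2
    have hn' : (n : ℝ) ≠ 0 := by exact_mod_cast hn0
    rw [Finset.sum_apply]
    calc ∑ k : Fin (n + 1), b * ((k : ℝ) / n) * e k x
        = b / n * ∑ k : Fin (n + 1), (k : ℝ) * e k x := by
          rw [Finset.mul_sum]; exact Finset.sum_congr rfl fun k _ => by ring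
      _ = x := by simp only [e]; rw [h2]; field_simp
  · have h1 : ∀ k : Fin (n + 1), f (b * ((k : ℝ) / n)) • cfc (e k) Z =
        cfc (fun x => f (b * ((k : ℝ) / n)) * e k x) Z := fun k => by
      rw [← cfc_const_mul _ _ _ (hec k).continuousOn]
    simp only [h1]
    have hc : ∀ i : Fin (n + 1), ContinuousOn (fun x => f (b * ((i : ℝ) / n)) * e i x)
      (spectrum ℝ Z) := fun i => by have := hec i; fun_prop
    have hcs : ContinuousOn (∑ i : Fin (n + 1), fun x => f (b * ((i : ℝ) / n)) * e i x)
        (spectrum ℝ Z) := by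
      rw [show (∑ i : Fin (n + 1), fun x => f (b * ((i : ℝ) / n)) * e i x) =
        fun x => ∑ i : Fin (n + 1), f (b * ((i : ℝ) / n)) * e i x by ext; simp]
      exact continuousOn_finsetSum _ fun i _ => hc i
    rw [← cfc_sum_univ _ Z hc, ← Algebra.algebraMap_eq_smul_one, ← cfc_const ε Z,
      ← cfc_add Z _ _ hcs]
    refine cfc_mono (fun x hx => ?_) (hf.mono fun x hx => spectrum_nonneg_of_nonneg hZ hx)
      (hcs.add continuousOn_const)
    have h3 := (ContinuousMap.dist_lt_iff hε).1 hn ⟨x / b, hspec x hx⟩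
    rw [bernsteinApproximation.apply, Real.dist_eq] at h3
    have h4 : F ⟨x / b, hspec x hx⟩ = f x := by
      simp only [F, ContinuousMap.coe_mk]; congr 1; field_simp
    have h5 : ∑ k : Fin (n + 1), bernstein n k ⟨x / b, hspec x hx⟩ • F (bernstein.z k) =
        ∑ k : Fin (n + 1), f (b * ((k : ℝ) / n)) * e k x :=
      Finset.sum_congr rfl fun k _ => by
        rw [he k x (hspec x hx), smul_eq_mul, mul_comm]; rfl
    rw [h4, h5] at h3
    simp only [Finset.sum_apply]
    linarith [neg_abs_le (∑ k : Fin (n + 1), f (b * ((k : ℝ) / n)) * e k x - f x)]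

/-- For scalars `l ≥ 0`, `t l / (t + l) |x|² = min_y (t |x - y|² + l |y|²)`. A positive map `Φ` carries
one direction of this variational formula over to a positive operator in place of `l`. No complete
positivity is needed, because only the commutative algebra generated by `Z` is involved: on a
discrete spectral measure `∑ l k • E k` the inequality holds summand by summand. -/
theorem reApplyInnerSelf_map_cfc_le (Φ : (H →L[ℂ] H) →ₗ[ℂ] (K →L[ℂ] K))
    (hΦ : ∀ X, 0 ≤ X → 0 ≤ Φ X) {Z : H →L[ℂ] H} (hZ : 0 ≤ Z) {t : ℝ} (ht : 0 < t) (x y : K) :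
    (Φ (cfc (fun u : ℝ => t * u / (t + u)) Z)).reApplyInnerSelf x ≤
      t * (Φ 1).reApplyInnerSelf (x - y) + (Φ Z).reApplyInnerSelf y := by
  refine le_of_forall_pos_le_add fun δ hδ => ?_
  have hm1 := reApplyInnerSelf_nonneg (hΦ 1 zero_le_one) x
  set m := (Φ 1).reApplyInnerSelf x
  have hf : ContinuousOn (fun u : ℝ => t * u / (t + u)) (Set.Ici 0) := by
    refine ContinuousOn.div (by fun_prop) (by fun_prop) fun u hu => ?_
    have : 0 ≤ u := hu
    positivity
  obtain ⟨n, E, l, hE, hl, hE1, hEZ, hle⟩ :=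
    exists_bernstein_partition hZ hf (ε := δ / (m + 1)) (by positivity)
  have hr : ∀ (c : ℝ) (X : H →L[ℂ] H), Φ (c • X) = c • Φ X := fun c X => by
    rw [← Complex.coe_smul c X, map_smul, Complex.coe_smul]
  have hmono : ∀ X Y : H →L[ℂ] H, X ≤ Y → Φ X ≤ Φ Y := fun X Y h => by
    rw [← sub_nonneg, ← map_sub]; exact hΦ _ (sub_nonneg.2 h)
  have hsum : ∀ (c : Fin (n + 1) → ℝ) (z : K), (Φ (∑ k, c k • E k)).reApplyInnerSelf z =
      ∑ k, c k * (Φ (E k)).reApplyInnerSelf z := fun c z => by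
    simp [map_sum, hr, ContinuousLinearMap.reApplyInnerSelf_apply, sum_inner,
      inner_smul_left_eq_smul]
  have h1 := reApplyInnerSelf_mono (hmono _ _ hle) x
  have h2 : (Φ (∑ k, (t * l k / (t + l k)) • E k + (δ / (m + 1)) • 1)).reApplyInnerSelf x =
      ∑ k, (t * l k / (t + l k)) * (Φ (E k)).reApplyInnerSelf x + δ / (m + 1) * m := by
    rw [← hsum]
    rw [map_add, hr (δ / (m + 1))]
    generalize δ / (m + 1) = c
    simp [ContinuousLinearMap.reApplyInnerSelf_apply, inner_add_left,
      inner_smul_left_eq_smul, m]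
  rw [h2] at h1
  have h3 : δ / (m + 1) * m ≤ δ := by
    rw [div_mul_eq_mul_div, div_le_iff₀ (by positivity)]; nlinarith
  have h4 : (Φ Z).reApplyInnerSelf y = ∑ k, l k * (Φ (E k)).reApplyInnerSelf y := by
    rw [← hsum, hEZ]
  have h5 : (Φ 1).reApplyInnerSelf (x - y) = ∑ k, (Φ (E k)).reApplyInnerSelf (x - y) := by
    have := hsum (fun _ => 1) (x - y)
    simpa [hE1] using this
  have h6 : ∑ k, (t * l k / (t + l k)) * (Φ (E k)).reApplyInnerSelf x ≤
      t * ∑ k, (Φ (E k)).reApplyInnerSelf (x - y) + ∑ k, l k * (Φ (E k)).reApplyInnerSelf y := by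
    rw [Finset.mul_sum, ← Finset.sum_add_distrib]
    refine Finset.sum_le_sum fun k _ => ?_
    have hP := hΦ _ (hE k)
    have hs := ((ContinuousLinearMap.nonneg_iff_isPositive _).1 hP).isSymmetric
    have hd : 0 < t + l k := by have := hl k; positivity
    -- the difference of the two sides is a perfect square
    have h7 := reApplyInnerSelf_nonneg hP
      (((t + l k : ℝ) : ℂ) • y - ((t : ℝ) : ℂ) • x)
    have hyx : (inner ℂ ((Φ (E k)) y) x).re = (inner ℂ ((Φ (E k)) x) y).re := by
      have := hs y x
      simp only [ContinuousLinearMap.coe_coe] at this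
      rw [this, ← inner_conj_symm, Complex.conj_re]
    simp only [ContinuousLinearMap.reApplyInnerSelf_apply, map_sub, map_smul, inner_sub_left,
      inner_sub_right, inner_smul_left, inner_smul_right, Complex.conj_ofReal,
      RCLike.re_to_complex, Complex.sub_re, Complex.re_ofReal_mul, hyx] at h7 ⊢
    set p := (inner ℂ ((Φ (E k)) x) x).re
    set q := (inner ℂ ((Φ (E k)) x) y).re
    set r := (inner ℂ ((Φ (E k)) y) y).re
    rw [div_mul_eq_mul_div, div_le_iff₀ hd]
    nlinarith [h7]
  rw [h4, h5]
  linarith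


/-- Jensen's inequality for the functions `u ↦ t u / (t + u)`. On the right-hand side the variational
formula is attained, at `y = t (t + S)⁻¹ x` with `S = ∑ Φ_j(Z_j)`. -/
theorem sum_map_cfc_le {ι : Type*} [Fintype ι] (Φ : ι → (H →L[ℂ] H) →ₗ[ℂ] (K →L[ℂ] K))
    (hΦ : ∀ j X, 0 ≤ X → 0 ≤ Φ j X) (h1 : ∑ j, Φ j 1 ≤ 1) {Z : ι → H →L[ℂ] H}
    (hZ : ∀ j, 0 ≤ Z j) {t : ℝ} (ht : 0 < t) :
    ∑ j, Φ j (cfc (fun u : ℝ => t * u / (t + u)) (Z j)) ≤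
      cfc (fun u : ℝ => t * u / (t + u)) (∑ j, Φ j (Z j)) := by
  set S := ∑ j, Φ j (Z j) with hSdef
  have hS : 0 ≤ S := Finset.sum_nonneg fun j _ => hΦ j _ (hZ j)
  have hpos : ∀ u ∈ spectrum ℝ S, 0 < t + u := fun u hu => by
    have : 0 ≤ u := spectrum_nonneg_of_nonneg hS hu
    positivity
  have hc : ContinuousOn (fun u : ℝ => t / (t + u)) (spectrum ℝ S) :=
    continuousOn_const.div (by fun_prop) fun u hu => (hpos u hu).ne'
  have hL : 0 ≤ ∑ j, Φ j (cfc (fun u : ℝ => t * u / (t + u)) (Z j)) :=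
    Finset.sum_nonneg fun j _ => hΦ j _ <| cfc_nonneg fun u hu => by
      have : 0 ≤ u := spectrum_nonneg_of_nonneg (hZ j) hu
      positivity
  refine le_of_reApplyInnerSelf_le (.of_nonneg hL) (cfc_predicate _ _) fun x => ?_
  -- the minimiser of `t * ‖x - y‖ ^ 2 + ⟪S y, y⟫` over `y`
  set R := cfc (fun u : ℝ => t / (t + u)) S
  have hRsa : IsSelfAdjoint R := cfc_predicate _ _
  have hsum : ∀ (T : ι → K →L[ℂ] K) (z : K), (∑ j, T j).reApplyInnerSelf z =
      ∑ j, (T j).reApplyInnerSelf z := fun T z => by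
    simp [ContinuousLinearMap.reApplyInnerSelf_apply, sum_inner]
  have h2 : (∑ j, Φ j (cfc (fun u : ℝ => t * u / (t + u)) (Z j))).reApplyInnerSelf x ≤
      t * (1 : K →L[ℂ] K).reApplyInnerSelf (x - R x) + S.reApplyInnerSelf (R x) := by
    have h3 := mul_le_mul_of_nonneg_left (reApplyInnerSelf_mono h1 (x - R x)) ht.le
    rw [hsum] at h3
    rw [hsum, hSdef, hsum]
    refine (Finset.sum_le_sum fun j _ =>
      reApplyInnerSelf_map_cfc_le (Φ j) (hΦ j) (hZ j) ht x (R x)).trans ?_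
    rw [Finset.sum_add_distrib, ← Finset.mul_sum]
    linarith
  refine h2.trans (le_of_eq ?_)
  have hconj : ∀ (T Q : K →L[ℂ] K), IsSelfAdjoint Q →
      T.reApplyInnerSelf (Q x) = (Q * T * Q).reApplyInnerSelf x := fun T Q hQ => by
    have := hQ.isSymmetric (T (Q x)) x
    simp only [ContinuousLinearMap.coe_coe] at this
    simp only [ContinuousLinearMap.reApplyInnerSelf_apply, mul_apply_eq_comp, this]
  have h4 : cfc (fun u : ℝ => t * u / (t + u)) S =
      t • ((1 - R) * 1 * (1 - R)) + R * S * R := by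
    have h5 : 1 - R = cfc (fun u : ℝ => 1 - t / (t + u)) S := by
      rw [cfc_sub _ _ S continuousOn_const hc, cfc_const_one ℝ S]
    have hc1 : ContinuousOn (fun u : ℝ => 1 - t / (t + u)) (spectrum ℝ S) :=
      continuousOn_const.sub hc
    have hcid : ContinuousOn (fun u : ℝ => t / (t + u) * u) (spectrum ℝ S) :=
      hc.mul continuousOn_id
    have hc2 : ContinuousOn (fun u : ℝ => (1 - t / (t + u)) * (1 - t / (t + u))) (spectrum ℝ S) :=
      hc1.mul hc1
    have hc3 : ContinuousOn (fun u : ℝ => t * ((1 - t / (t + u)) * (1 - t / (t + u))))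
      (spectrum ℝ S) := continuousOn_const.mul hc2
    have hc4 : ContinuousOn (fun u : ℝ => t / (t + u) * u * (t / (t + u))) (spectrum ℝ S) :=
      hcid.mul hc
    have h6 : R * S * R = cfc (fun u : ℝ => t / (t + u) * u * (t / (t + u))) S := by
      rw [cfc_mul (fun u : ℝ => t / (t + u) * u) _ S hcid hc,
        cfc_mul (fun u : ℝ => t / (t + u)) (fun u => u) S hc continuousOn_id, cfc_id' ℝ S]
    rw [h5, h6, mul_one, ← cfc_mul _ _ S hc1 hc1, ← cfc_const_mul t _ S hc2,
      ← cfc_add S _ _ hc3 hc4]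
    refine cfc_congr fun u hu => ?_
    have := (hpos u hu).ne'
    field_simp
    ring
  have h7 : x - R x = (1 - R) x := by simp
  rw [h4, h7, hconj _ _ ((IsSelfAdjoint.one _).sub hRsa), hconj _ _ hRsa]
  simp [ContinuousLinearMap.reApplyInnerSelf_apply, inner_add_left, inner_smul_left_eq_smul]

/-- The integral representation of `a ↦ a ^ p` for `0 < p < 1`, with a measure `μ` that does not depend
on the C⋆-algebra. Mathlib's existential version chooses `μ` for one algebra at a time, whereas
Jensen's inequality compares two. -/
theorem rpow_eq_setIntegral_cfc {A : Type*} [CStarAlgebra A] [PartialOrder A] [StarOrderedRing A]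
    {p : ℝ} (hp : p ∈ Set.Ioo 0 1) {μ : MeasureTheory.Measure ℝ}
    (hμ : ∀ x ∈ Set.Ici (0 : ℝ),
      MeasureTheory.IntegrableOn (fun t => Real.rpowIntegrand₀₁ p t x) (Set.Ioi 0) μ ∧
        x ^ p = ∫ t in Set.Ioi 0, Real.rpowIntegrand₀₁ p t x ∂μ) {a : A} (ha : 0 ≤ a) :
    MeasureTheory.IntegrableOn (fun t => cfc (Real.rpowIntegrand₀₁ p t) a) (Set.Ioi 0) μ ∧
      a ^ p = ∫ t in Set.Ioi 0, cfc (Real.rpowIntegrand₀₁ p t) a ∂μ := by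
  have hspec : ∀ z ∈ spectrum ℝ a, 0 ≤ z ∧ z ≤ ‖a‖ := fun z hz => by
    have : Nontrivial A := by
      by_contra h
      rw [not_nontrivial_iff_subsingleton] at h
      simp [spectrum.of_subsingleton] at hz
    exact ⟨spectrum_nonneg_of_nonneg ha hz,
      (le_abs_self z).trans (spectrum.norm_le_norm_of_mem hz)⟩
  have hf : ContinuousOn (Function.uncurry (Real.rpowIntegrand₀₁ p))
      (Set.Ioi (0 : ℝ) ×ˢ spectrum ℝ a) :=
    Real.continuousOn_rpowIntegrand₀₁_uncurry hp _ fun z hz => (hspec z hz).1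
  have hbound : ∀ᵐ t ∂μ.restrict (Set.Ioi 0), ∀ z ∈ spectrum ℝ a,
      ‖Real.rpowIntegrand₀₁ p t z‖ ≤ ‖Real.rpowIntegrand₀₁ p t ‖a‖‖ := by
    filter_upwards [MeasureTheory.ae_restrict_mem measurableSet_Ioi] with t ht z hz
    have ht : 0 < t := ht
    rw [Real.norm_of_nonneg (Real.rpowIntegrand₀₁_nonneg hp.1 ht.le (hspec z hz).1),
      Real.norm_of_nonneg (Real.rpowIntegrand₀₁_nonneg hp.1 ht.le (norm_nonneg a))]
    exact Real.rpowIntegrand₀₁_monotoneOn hp ht.le (hspec z hz).1 (norm_nonneg a) (hspec z hz).2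
  have hfin : MeasureTheory.HasFiniteIntegral (fun t => ‖Real.rpowIntegrand₀₁ p t ‖a‖‖)
      (μ.restrict (Set.Ioi 0)) := by
    rw [MeasureTheory.hasFiniteIntegral_norm_iff]
    exact (hμ ‖a‖ (norm_nonneg a)).1.2
  refine ⟨integrableOn_cfc measurableSet_Ioi _ _ a hf hbound hfin, ?_⟩
  rw [← cfc_setIntegral measurableSet_Ioi _ _ a hf hbound hfin (.of_nonneg ha),
    CFC.rpow_eq_cfc_real ha]
  exact cfc_congr fun r hr => (hμ r (hspec r hr).1).2

/-- The operator Jensen inequality for powers in `[0, 1]`: if `Φ_j` are positive maps with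
`∑ Φ_j(1) ≤ 1`, then `∑ Φ_j(Z_j ^ α) ≤ (∑ Φ_j(Z_j)) ^ α`. -/
theorem sum_map_rpow_le {ι : Type*} [Fintype ι] (Φ : ι → (H →L[ℂ] H) →ₗ[ℂ] (K →L[ℂ] K))
    (hΦ : ∀ j X, 0 ≤ X → 0 ≤ Φ j X) (h1 : ∑ j, Φ j 1 ≤ 1) {Z : ι → H →L[ℂ] H}
    (hZ : ∀ j, 0 ≤ Z j) {α : ℝ} (hα₀ : 0 ≤ α) (hα₁ : α ≤ 1) :
    ∑ j, Φ j (Z j ^ α) ≤ (∑ j, Φ j (Z j)) ^ α := by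
  have hS : 0 ≤ ∑ j, Φ j (Z j) := Finset.sum_nonneg fun j _ => hΦ j _ (hZ j)
  rcases hα₀.eq_or_lt with rfl | h0
  · simpa only [CFC.rpow_zero _ (hZ _), CFC.rpow_zero _ hS] using h1
  rcases hα₁.eq_or_lt with rfl | hlt
  · simp only [CFC.rpow_one _ (hZ _), CFC.rpow_one _ hS, le_refl]
  have hp : α ∈ Set.Ioo (0 : ℝ) 1 := ⟨h0, hlt⟩
  obtain ⟨μ, hμ⟩ := Real.exists_measure_rpow_eq_integral_rpowIntegrand₀₁ hp
  -- positive maps between C⋆-algebras are automatically continuous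
  let Ψ : ι → (H →L[ℂ] H) →L[ℂ] (K →L[ℂ] K) := fun j =>
    ⟨Φ j, map_continuous (PositiveLinearMap.mk₀ (Φ j) (hΦ j))⟩
  have hint : ∀ j, MeasureTheory.IntegrableOn
      (fun t => Φ j (cfc (Real.rpowIntegrand₀₁ α t) (Z j))) (Set.Ioi 0) μ := fun j =>
    (Ψ j).integrable_comp (rpow_eq_setIntegral_cfc hp hμ (hZ j)).1
  have hL : ∑ j, Φ j (Z j ^ α) =
      ∫ t in Set.Ioi 0, ∑ j, Φ j (cfc (Real.rpowIntegrand₀₁ α t) (Z j)) ∂μ := by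
    rw [MeasureTheory.integral_finsetSum _ fun j _ => hint j]
    refine Finset.sum_congr rfl fun j _ => ?_
    obtain ⟨hi, he⟩ := rpow_eq_setIntegral_cfc hp hμ (hZ j)
    rw [he]
    exact ((Ψ j).integral_comp_comm hi).symm
  obtain ⟨hi, he⟩ := rpow_eq_setIntegral_cfc hp hμ hS
  rw [hL, he]
  refine MeasureTheory.integral_mono_ae
    (MeasureTheory.integrable_finsetSum _ fun j _ => hint j) hi ?_
  filter_upwards [MeasureTheory.ae_restrict_mem measurableSet_Ioi] with t ht
  have ht : 0 < t := ht
  have hres : ∀ u, 0 ≤ u → Real.rpowIntegrand₀₁ α t u = t ^ (α - 2) * (t * u / (t + u)) :=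
    fun u hu => by
      rw [Real.rpowIntegrand₀₁_eq_pow_div hp ht.le hu, show α - 1 = α - 2 + 1 by ring,
        Real.rpow_add_one ht.ne']
      ring
  have hcont : ∀ s : Set ℝ, (∀ u ∈ s, 0 ≤ u) → ContinuousOn (fun u => t * u / (t + u)) s :=
    fun s hs => ContinuousOn.div (by fun_prop) (by fun_prop) fun u hu => by
      have := hs u hu; positivity
  have h2 : ∀ j, Φ j (cfc (Real.rpowIntegrand₀₁ α t) (Z j)) =
      t ^ (α - 2) • Φ j (cfc (fun u : ℝ => t * u / (t + u)) (Z j)) := fun j => by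
    have hs : ∀ u ∈ spectrum ℝ (Z j), 0 ≤ u := fun u hu => spectrum_nonneg_of_nonneg (hZ j) hu
    rw [cfc_congr fun u hu => hres u (hs u hu), cfc_const_mul _ _ _ (hcont _ hs),
      ← Complex.coe_smul, map_smul, Complex.coe_smul]
  have hs : ∀ u ∈ spectrum ℝ (∑ j, Φ j (Z j)), 0 ≤ u :=
    fun u hu => spectrum_nonneg_of_nonneg hS hu
  change ∑ j, Φ j (cfc (Real.rpowIntegrand₀₁ α t) (Z j)) ≤ _
  rw [cfc_congr fun u hu => hres u (hs u hu), cfc_const_mul _ _ _ (hcont _ hs)]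
  simp only [h2]
  rw [← Finset.smul_sum]
  exact smul_le_smul_of_nonneg_left (sum_map_cfc_le Φ hΦ h1 hZ ht) (by positivity)

end Jensen

/-! ### Weighted geometric means of invertible operators -/

section Invertible

variable {H : Type*} [NormedAddCommGroup H] [InnerProductSpace ℂ H] [CompleteSpace H]
variable {K : Type*} [NormedAddCommGroup K] [InnerProductSpace ℂ K] [CompleteSpace K]

theorem isSelfAdjoint_rpow (A : H →L[ℂ] H) (r : ℝ) : IsSelfAdjoint (A ^ r) :=
  .of_nonneg CFC.rpow_nonneg

theorem rpow_half_mul_self {A : H →L[ℂ] H} (hA : IsStrictlyPositive A) :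
    A ^ (1 / 2 : ℝ) * A ^ (1 / 2 : ℝ) = A := by
  rw [← CFC.rpow_add hA.isUnit, add_halves, CFC.rpow_one A hA.nonneg]

theorem rpow_half_mul_neg {A : H →L[ℂ] H} (hA : IsStrictlyPositive A) :
    A ^ (1 / 2 : ℝ) * A ^ (-(1 / 2) : ℝ) = 1 := CFC.rpow_mul_rpow_neg _ hA

theorem rpow_neg_mul_half {A : H →L[ℂ] H} (hA : IsStrictlyPositive A) :
    A ^ (-(1 / 2) : ℝ) * A ^ (1 / 2 : ℝ) = 1 := CFC.rpow_neg_mul_rpow _ hA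

theorem geomMeanFormula_nonneg (α : ℝ) (A B : H →L[ℂ] H) : 0 ≤ geomMeanFormula α A B :=
  (isSelfAdjoint_rpow A _).conjugate_nonneg CFC.rpow_nonneg

theorem isStrictlyPositive_rpow_conj {A B : H →L[ℂ] H} (r : ℝ) (hA : IsStrictlyPositive A)
    (hB : IsStrictlyPositive B) : IsStrictlyPositive (A ^ r * B * A ^ r) :=
  .conjugate_of_isUnit_of_isSelfAdjoint B (A ^ r) (hA.isUnit.cfcRpow r hA.nonneg)
    (isSelfAdjoint_rpow A r) hB

theorem isStrictlyPositive_geomMeanFormula (α : ℝ) {A B : H →L[ℂ] H} (hA : IsStrictlyPositive A)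
    (hB : IsStrictlyPositive B) : IsStrictlyPositive (geomMeanFormula α A B) :=
  isStrictlyPositive_rpow_conj _ hA
    (IsStrictlyPositive.rpow _ α (isStrictlyPositive_rpow_conj _ hA hB))

/-- The map `X ↦ P X P`, a congruence when `P` is self-adjoint. -/
def conjMap (P : H →L[ℂ] H) : (H →L[ℂ] H) →ₗ[ℂ] (H →L[ℂ] H) :=
  LinearMap.mulLeft ℂ P ∘ₗ LinearMap.mulRight ℂ P

omit [CompleteSpace H] in
theorem conjMap_apply (P X : H →L[ℂ] H) : conjMap P X = P * X * P := by
  simp [conjMap, mul_assoc]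

/-- Ando's inequality for a finite family of positive maps and invertible operators. Jensen's inequality
is applied to the maps `X ↦ C^{-1/2} Φ_j(A_j^{1/2} X A_j^{1/2}) C^{-1/2}`, which are jointly
subunital because `∑ Φ_j(A_j) ≤ C`. Allowing inequalities in the hypotheses makes joint monotonicity
and congruence invariance of the mean special cases. -/
theorem sum_map_geomMeanFormula_le {ι : Type*} [Fintype ι]
    (Φ : ι → (H →L[ℂ] H) →ₗ[ℂ] (K →L[ℂ] K)) (hΦ : ∀ j X, 0 ≤ X → 0 ≤ Φ j X)
    {α : ℝ} (hα₀ : 0 ≤ α) (hα₁ : α ≤ 1) {A B : ι → H →L[ℂ] H} {C D : K →L[ℂ] K}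
    (hA : ∀ j, IsStrictlyPositive (A j)) (hB : ∀ j, 0 ≤ B j) (hC : IsStrictlyPositive C)
    (hAC : ∑ j, Φ j (A j) ≤ C) (hBD : ∑ j, Φ j (B j) ≤ D) :
    ∑ j, Φ j (geomMeanFormula α (A j) (B j)) ≤ geomMeanFormula α C D := by
  set P := C ^ (-(1 / 2) : ℝ)
  set R := C ^ (1 / 2 : ℝ)
  have hPsa : IsSelfAdjoint P := isSelfAdjoint_rpow _ _
  have hRsa : IsSelfAdjoint R := isSelfAdjoint_rpow _ _
  have hRP : R * P = 1 := rpow_half_mul_neg hC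
  have hPR : P * R = 1 := rpow_neg_mul_half hC
  have hRR : R * R = C := rpow_half_mul_self hC
  let Q : ι → H →L[ℂ] H := fun j => A j ^ (1 / 2 : ℝ)
  let N : ι → H →L[ℂ] H := fun j => A j ^ (-(1 / 2) : ℝ)
  have hQN : ∀ j, Q j * N j = 1 := fun j => rpow_half_mul_neg (hA j)
  have hNQ : ∀ j, N j * Q j = 1 := fun j => rpow_neg_mul_half (hA j)
  have hQQ : ∀ j, Q j * Q j = A j := fun j => rpow_half_mul_self (hA j)
  let Ψ : ι → (H →L[ℂ] H) →ₗ[ℂ] (K →L[ℂ] K) := fun j => conjMap P ∘ₗ Φ j ∘ₗ conjMap (Q j)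
  have hΨ : ∀ j X, Ψ j X = P * Φ j (Q j * X * Q j) * P := fun j X => by
    simp [Ψ, conjMap_apply]
  have hΨpos : ∀ j X, 0 ≤ X → 0 ≤ Ψ j X := fun j X hX => by
    rw [hΨ]
    exact hPsa.conjugate_nonneg (hΦ j _ ((isSelfAdjoint_rpow _ _).conjugate_nonneg hX))
  have hΨsum : ∀ X : ι → H →L[ℂ] H,
      ∑ j, Ψ j (X j) = P * (∑ j, Φ j (Q j * X j * Q j)) * P := fun X => by
    simp only [hΨ, Finset.mul_sum, Finset.sum_mul]
  have hΨ1 : ∑ j, Ψ j 1 ≤ 1 := by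
    rw [hΨsum fun _ => 1]
    simp only [mul_one, hQQ]
    refine (hPsa.conjugate_le_conjugate hAC).trans (le_of_eq ?_)
    rw [← hRR, mul_assoc, mul_assoc, hRP, mul_one, hPR]
  have hZ : ∀ j, 0 ≤ N j * B j * N j := fun j =>
    (isSelfAdjoint_rpow _ _).conjugate_nonneg (hB j)
  have hQZ : ∀ j, Q j * (N j * B j * N j) * Q j = B j := fun j => by
    rw [← mul_assoc, ← mul_assoc, hQN, one_mul, mul_assoc, hNQ, mul_one]
  have h1 := sum_map_rpow_le Ψ hΨpos hΨ1 hZ hα₀ hα₁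
  rw [hΨsum, hΨsum] at h1
  simp only [hQZ] at h1
  have h2 := h1.trans (CFC.rpow_le_rpow ⟨hα₀, hα₁⟩ (hPsa.conjugate_le_conjugate hBD))
  have h3 := hRsa.conjugate_le_conjugate h2
  rw [← mul_assoc, ← mul_assoc, hRP, one_mul, mul_assoc, hPR, mul_one] at h3
  exact h3

theorem map_geomMeanFormula_le (Φ : (H →L[ℂ] H) →ₗ[ℂ] (K →L[ℂ] K)) (hΦ : ∀ X, 0 ≤ X → 0 ≤ Φ X)
    {α : ℝ} (hα₀ : 0 ≤ α) (hα₁ : α ≤ 1) {A B : H →L[ℂ] H} {C D : K →L[ℂ] K}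
    (hA : IsStrictlyPositive A) (hB : 0 ≤ B) (hC : IsStrictlyPositive C)
    (hAC : Φ A ≤ C) (hBD : Φ B ≤ D) :
    Φ (geomMeanFormula α A B) ≤ geomMeanFormula α C D := by
  simpa using sum_map_geomMeanFormula_le (fun _ : Unit => Φ) (fun _ => hΦ) hα₀ hα₁
    (A := fun _ => A) (B := fun _ => B) (fun _ => hA) (fun _ => hB) hC (by simpa) (by simpa)

theorem geomMeanFormula_mono {α : ℝ} (hα₀ : 0 ≤ α) (hα₁ : α ≤ 1) {A B C D : H →L[ℂ] H}
    (hA : IsStrictlyPositive A) (hB : 0 ≤ B) (hC : IsStrictlyPositive C)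
    (hAC : A ≤ C) (hBD : B ≤ D) : geomMeanFormula α A B ≤ geomMeanFormula α C D :=
  map_geomMeanFormula_le LinearMap.id (fun _ h => h) hα₀ hα₁ hA hB hC hAC hBD

/-- Congruence invariance under an invertible self-adjoint `P`, from Ando's inequality for
`X ↦ P X P` and for its inverse. -/
theorem geomMeanFormula_conj {α : ℝ} (hα₀ : 0 ≤ α) (hα₁ : α ≤ 1) {A B P R : H →L[ℂ] H}
    (hA : IsStrictlyPositive A) (hB : 0 ≤ B) (hP : IsSelfAdjoint P) (hR : IsSelfAdjoint R)
    (hPR : P * R = 1) (hRP : R * P = 1) :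
    geomMeanFormula α (P * A * P) (P * B * P) = P * geomMeanFormula α A B * P := by
  have hPA : IsStrictlyPositive (P * A * P) :=
    .conjugate_of_isUnit_of_isSelfAdjoint A P ⟨⟨P, R, hPR, hRP⟩, rfl⟩ hP hA
  have hcancel : ∀ X : H →L[ℂ] H, R * (P * X * P) * R = X := fun X => by
    rw [← mul_assoc, ← mul_assoc, hRP, one_mul, mul_assoc, hPR, mul_one]
  have hcancel' : ∀ X : H →L[ℂ] H, P * (R * X * R) * P = X := fun X => by
    rw [← mul_assoc, ← mul_assoc, hPR, one_mul, mul_assoc, hRP, mul_one]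
  refine le_antisymm ?_ ?_
  · have h := map_geomMeanFormula_le (conjMap R)
      (fun X hX => by rw [conjMap_apply]; exact hR.conjugate_nonneg hX) hα₀ hα₁
      (A := P * A * P) (B := P * B * P) (C := A) (D := B) hPA (hP.conjugate_nonneg hB) hA
      (by rw [conjMap_apply, hcancel]) (by rw [conjMap_apply, hcancel])
    rw [conjMap_apply] at h
    simpa only [hcancel'] using hP.conjugate_le_conjugate h
  · have h := map_geomMeanFormula_le (conjMap P)
      (fun X hX => by rw [conjMap_apply]; exact hP.conjugate_nonneg hX) hα₀ hα₁
      hA hB hPA (conjMap_apply P A).le (conjMap_apply P B).le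
    rwa [conjMap_apply] at h

theorem rpow_rpow_of_isStrictlyPositive {X : H →L[ℂ] H} (hX : IsStrictlyPositive X) (s t : ℝ) :
    (X ^ s) ^ t = X ^ (s * t) := by
  rcases eq_or_ne s 0 with rfl | hs
  · rw [CFC.rpow_zero X hX.nonneg, CFC.one_rpow, zero_mul, CFC.rpow_zero X hX.nonneg]
  · exact CFC.rpow_rpow X s t hs hX

theorem geomMeanFormula_rpow_rpow {X : H →L[ℂ] H} (hX : IsStrictlyPositive X) (α s t : ℝ) :
    geomMeanFormula α (X ^ s) (X ^ t) = X ^ ((1 - α) * s + α * t) := by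
  simp only [geomMeanFormula, rpow_rpow_of_isStrictlyPositive hX, ← CFC.rpow_add hX.isUnit]
  congr 1
  ring

/-- The curve `s ↦ A ♯_s B` is a geodesic: `(A ♯_s B) ♯_α (A ♯_t B) = A ♯_{(1-α)s+αt} B`. By congruence
invariance this is a statement about powers of the single operator `A^{-1/2} B A^{-1/2}`. -/
theorem geomMeanFormula_geomMeanFormula {α : ℝ} (hα₀ : 0 ≤ α) (hα₁ : α ≤ 1) (s t : ℝ)
    {A B : H →L[ℂ] H} (hA : IsStrictlyPositive A) (hB : IsStrictlyPositive B) :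
    geomMeanFormula α (geomMeanFormula s A B) (geomMeanFormula t A B) =
      geomMeanFormula ((1 - α) * s + α * t) A B := by
  have hX := isStrictlyPositive_rpow_conj (-(1 / 2) : ℝ) hA hB
  have h := geomMeanFormula_conj hα₀ hα₁ (A := (A ^ (-(1 / 2) : ℝ) * B * A ^ (-(1 / 2) : ℝ)) ^ s)
    (B := (A ^ (-(1 / 2) : ℝ) * B * A ^ (-(1 / 2) : ℝ)) ^ t)
    (P := A ^ (1 / 2 : ℝ)) (R := A ^ (-(1 / 2) : ℝ))
    (IsStrictlyPositive.rpow _ s hX) CFC.rpow_nonneg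
    (isSelfAdjoint_rpow _ _) (isSelfAdjoint_rpow _ _) (rpow_half_mul_neg hA) (rpow_neg_mul_half hA)
  rw [geomMeanFormula_rpow_rpow hX] at h
  exact h

theorem geomMeanFormula_zero {A B : H →L[ℂ] H} (hA : IsStrictlyPositive A) (hB : 0 ≤ B) :
    geomMeanFormula 0 A B = A := by
  rw [geomMeanFormula, CFC.rpow_zero _ ((isSelfAdjoint_rpow _ _).conjugate_nonneg hB), mul_one,
    rpow_half_mul_self hA]

theorem geomMeanFormula_one {A B : H →L[ℂ] H} (hA : IsStrictlyPositive A) (hB : 0 ≤ B) :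
    geomMeanFormula 1 A B = B := by
  rw [geomMeanFormula, CFC.rpow_one _ ((isSelfAdjoint_rpow _ _).conjugate_nonneg hB),
    ← mul_assoc, ← mul_assoc, rpow_half_mul_neg hA, one_mul, mul_assoc, rpow_neg_mul_half hA,
    mul_one]

/-- With `M = A ♯_α B`, `(M ♯_β A) ♯_α (M ♯_β B) = M`: the points `M ♯_β A` and `M ♯_β B` lie on the
geodesic from `A` to `B` at parameters `(1-β)α` and `(1-β)α + β`. -/
theorem geomMeanFormula_refine {α β : ℝ} (hα₀ : 0 ≤ α) (hα₁ : α ≤ 1) (hβ₀ : 0 ≤ β) (hβ₁ : β ≤ 1)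
    {A B : H →L[ℂ] H} (hA : IsStrictlyPositive A) (hB : IsStrictlyPositive B) :
    geomMeanFormula α (geomMeanFormula β (geomMeanFormula α A B) A)
      (geomMeanFormula β (geomMeanFormula α A B) B) = geomMeanFormula α A B := by
  have h0 := geomMeanFormula_geomMeanFormula hβ₀ hβ₁ α 0 hA hB
  have h1 := geomMeanFormula_geomMeanFormula hβ₀ hβ₁ α 1 hA hB
  rw [geomMeanFormula_zero hA hB.nonneg] at h0
  rw [geomMeanFormula_one hA hB.nonneg] at h1
  rw [h0, h1, geomMeanFormula_geomMeanFormula hα₀ hα₁ _ _ hA hB]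
  congr 1
  ring

end Invertible

/-! ### Bounded strong convergence -/

section Strong

variable {H : Type*} [NormedAddCommGroup H] [InnerProductSpace ℂ H] [CompleteSpace H]

omit [CompleteSpace H] in
theorem le_of_tendsto_apply {ι : Type*} {l : Filter ι} [l.NeBot] {f g : ι → H →L[ℂ] H}
    {S T : H →L[ℂ] H} (hf : ∀ x, Tendsto (fun i => f i x) l (𝓝 (S x)))
    (hg : ∀ x, Tendsto (fun i => g i x) l (𝓝 (T x))) (h : ∀ᶠ i in l, f i ≤ g i) : S ≤ T := by
  rw [ContinuousLinearMap.le_def, ContinuousLinearMap.isPositive_iff_complex]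
  intro x
  have hlim : Tendsto (fun i => inner ℂ ((g i - f i) x) x) l (𝓝 (inner ℂ ((T - S) x) x)) :=
    ((hg x).sub (hf x)).inner tendsto_const_nhds
  have hpos : ∀ᶠ i in l, ((RCLike.re (inner ℂ ((g i - f i) x) x) : ℝ) : ℂ) =
      inner ℂ ((g i - f i) x) x ∧ 0 ≤ RCLike.re (inner ℂ ((g i - f i) x) x) := by
    filter_upwards [h] with i hi
    exact (ContinuousLinearMap.isPositive_iff_complex _).1
      ((ContinuousLinearMap.le_def _ _).1 hi) x
  have hre := (RCLike.continuous_re.tendsto _).comp hlim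
  refine ⟨?_, ge_of_tendsto hre (hpos.mono fun i hi => hi.2)⟩
  refine tendsto_nhds_unique_of_eventuallyEq
    ((Complex.continuous_ofReal.tendsto _).comp hre) hlim (hpos.mono fun i hi => hi.1)

/-- Convergence of operators along a filter in the strong operator topology, together with an
eventual bound on the norms. Unlike plain strong convergence along a general filter, this is
preserved by products and by continuous functional calculus. -/
structure BoundedStrongTendsto {ι : Type*} (f : ι → H →L[ℂ] H) (l : Filter ι)
    (T : H →L[ℂ] H) : Prop where
  bounded : ∃ c : ℝ, ∀ᶠ i in l, ‖f i‖ ≤ c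
  tendsto : ∀ x, Tendsto (fun i => f i x) l (𝓝 (T x))

namespace BoundedStrongTendsto

variable {ι : Type*} {l : Filter ι} {f g : ι → H →L[ℂ] H} {S T : H →L[ℂ] H}

omit [CompleteSpace H] in
theorem of_tendsto (h : Tendsto f l (𝓝 T)) : BoundedStrongTendsto f l T where
  bounded := ⟨‖T‖ + 1, (h.norm.eventually_lt_const (lt_add_one _)).mono fun _ hi => hi.le⟩
  tendsto x := ((ContinuousLinearMap.apply ℂ H x).continuous.tendsto _).comp h

omit [CompleteSpace H] in
theorem const (T : H →L[ℂ] H) : BoundedStrongTendsto (fun _ : ι => T) l T :=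
  of_tendsto tendsto_const_nhds

omit [CompleteSpace H] in
theorem add (hf : BoundedStrongTendsto f l S) (hg : BoundedStrongTendsto g l T) :
    BoundedStrongTendsto (fun i => f i + g i) l (S + T) where
  bounded := by
    obtain ⟨c, hc⟩ := hf.bounded
    obtain ⟨d, hd⟩ := hg.bounded
    exact ⟨c + d, by
      filter_upwards [hc, hd] with i h1 h2 using (norm_add_le _ _).trans (add_le_add h1 h2)⟩
  tendsto x := (hf.tendsto x).add (hg.tendsto x)

omit [CompleteSpace H] in
theorem mul (hf : BoundedStrongTendsto f l S) (hg : BoundedStrongTendsto g l T) :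
    BoundedStrongTendsto (fun i => f i * g i) l (S * T) where
  bounded := by
    obtain ⟨c, hc⟩ := hf.bounded
    obtain ⟨d, hd⟩ := hg.bounded
    exact ⟨c * d, by
      filter_upwards [hc, hd] with i h1 h2 using (norm_mul_le _ _).trans
        (mul_le_mul h1 h2 (norm_nonneg _) ((norm_nonneg _).trans h1))⟩
  tendsto x := by
    obtain ⟨c, hc⟩ := hf.bounded
    -- `f g x - S T x = f (g x - T x) + (f - S) T x`
    have h1 : Tendsto (fun i => f i (g i x - T x)) l (𝓝 0) := by
      refine squeeze_zero_norm' (a := fun i => c * ‖g i x - T x‖) ?_ ?_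
      · filter_upwards [hc] with i hi
        exact ((f i).le_opNorm _).trans (mul_le_mul_of_nonneg_right hi (norm_nonneg _))
      · simpa using ((tendsto_iff_norm_sub_tendsto_zero.1 (hg.tendsto x)).const_mul c)
    simpa using h1.add (hf.tendsto (T x))

omit [CompleteSpace H] in
theorem pow (hf : BoundedStrongTendsto f l T) (n : ℕ) :
    BoundedStrongTendsto (fun i => f i ^ n) l (T ^ n) := by
  induction n with
  | zero => simpa using const 1
  | succ n ih => simpa only [pow_succ] using ih.mul hf

omit [CompleteSpace H] in
theorem aeval (hf : BoundedStrongTendsto f l T) (p : Polynomial ℝ) :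
    BoundedStrongTendsto (fun i => Polynomial.aeval (f i) p) l (Polynomial.aeval T p) := by
  induction p using Polynomial.induction_on' with
  | add p q hp hq => simpa only [map_add] using hp.add hq
  | monomial n a =>
    simpa only [Polynomial.aeval_monomial] using (const (algebraMap ℝ (H →L[ℂ] H) a)).mul (hf.pow n)

/-- Continuous functional calculus preserves bounded strong convergence: true for polynomials, hence
for continuous functions by the Weierstrass approximation theorem. -/
theorem cfc_of_spectrum_subset (hf : BoundedStrongTendsto f l T) {a b : ℝ} {φ : ℝ → ℝ}
    (hφ : ContinuousOn φ (Set.Icc a b))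
    (hfs : ∀ᶠ i in l, IsSelfAdjoint (f i) ∧ spectrum ℝ (f i) ⊆ Set.Icc a b)
    (hT : IsSelfAdjoint T) (hTs : spectrum ℝ T ⊆ Set.Icc a b) :
    BoundedStrongTendsto (fun i => cfc φ (f i)) l (cfc φ T) where
  bounded := by
    obtain ⟨C, hC⟩ := isCompact_Icc.exists_bound_of_continuousOn hφ
    refine ⟨max C 0, hfs.mono fun i hi => norm_cfc_le (le_max_right _ _) fun x hx => ?_⟩
    exact (hC x (hi.2 hx)).trans (le_max_left _ _)
  tendsto x := by
    rw [Metric.tendsto_nhds]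
    intro ε hε
    set δ := ε / (3 * (‖x‖ + 1)) with hδdef
    have hδ : 0 < δ := by positivity
    have hδx : δ * ‖x‖ ≤ ε / 3 := by
      rw [hδdef, div_mul_eq_mul_div, div_le_div_iff₀ (by positivity) (by norm_num)]
      nlinarith [norm_nonneg x]
    obtain ⟨p, hp⟩ := exists_polynomial_near_of_continuousOn a b φ hφ δ hδ
    have hnear : ∀ X : H →L[ℂ] H, IsSelfAdjoint X → spectrum ℝ X ⊆ Set.Icc a b →
        ‖(cfc φ X) x - (Polynomial.aeval X p) x‖ ≤ ε / 3 := fun X hX hXs => by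
      rw [← sub_apply, ← cfc_polynomial p X hX,
        ← cfc_sub φ p.eval X (hφ.mono hXs) (by fun_prop)]
      refine (ContinuousLinearMap.le_opNorm _ _).trans
        ((mul_le_mul_of_nonneg_right ?_ (norm_nonneg _)).trans hδx)
      refine norm_cfc_le hδ.le fun u hu => ?_
      rw [Real.norm_eq_abs, abs_sub_comm]
      exact (hp u (hXs hu)).le
    filter_upwards [hfs, Metric.tendsto_nhds.1 ((hf.aeval p).tendsto x) (ε / 3) (by positivity)]
      with i hi hi2
    rw [dist_eq_norm] at hi2 ⊢
    have h1 := hnear _ hi.1 hi.2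
    have h2 := hnear T hT hTs
    rw [norm_sub_rev] at h2
    calc ‖(cfc φ (f i)) x - (cfc φ T) x‖
        = ‖((cfc φ (f i)) x - (Polynomial.aeval (f i) p) x) +
            ((Polynomial.aeval (f i) p) x - (Polynomial.aeval T p) x) +
            ((Polynomial.aeval T p) x - (cfc φ T) x)‖ := by congr 1; abel
      _ ≤ _ := norm_add₃_le
      _ < ε := by linarith

/-- Powers preserve bounded strong convergence of operators bounded below by `m ≥ 0`; negative powers
need `m > 0`. -/
theorem rpow [l.NeBot] (hf : BoundedStrongTendsto f l T) {m r : ℝ} (hm : 0 ≤ m)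
    (hmr : 0 < m ∨ 0 ≤ r) (hfm : ∀ᶠ i in l, algebraMap ℝ (H →L[ℂ] H) m ≤ f i) :
    BoundedStrongTendsto (fun i => f i ^ r) l (T ^ r) := by
  have hm' : (0 : H →L[ℂ] H) ≤ algebraMap ℝ (H →L[ℂ] H) m := algebraMap_nonneg _ hm
  have hTm : algebraMap ℝ (H →L[ℂ] H) m ≤ T :=
    le_of_tendsto_apply (fun x => tendsto_const_nhds) hf.tendsto hfm
  obtain ⟨c, hc⟩ := hf.bounded
  have hspec : ∀ X : H →L[ℂ] H, algebraMap ℝ (H →L[ℂ] H) m ≤ X → ∀ d, ‖X‖ ≤ d → IsSelfAdjoint X ∧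
      spectrum ℝ X ⊆ Set.Icc m d := fun X hX d hd => by
    have hsa : IsSelfAdjoint X := .of_nonneg (hm'.trans hX)
    refine ⟨hsa, fun u hu => ⟨(algebraMap_le_iff_le_spectrum hsa).1 hX u hu, ?_⟩⟩
    exact ((le_algebraMap_iff_spectrum_le hsa).1 hsa.le_algebraMap_norm_self u hu).trans hd
  have hφ : ContinuousOn (fun u : ℝ => u ^ r) (Set.Icc m (max c ‖T‖)) := fun u hu =>
    (Real.continuousAt_rpow_const u r
      (hmr.imp (fun h => (h.trans_le hu.1).ne') id)).continuousWithinAt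
  have hTs := hspec T hTm _ (le_max_right c ‖T‖)
  have key := hf.cfc_of_spectrum_subset hφ
    (by filter_upwards [hfm, hc] with i h1 h2 using hspec _ h1 _ (h2.trans (le_max_left _ _)))
    hTs.1 hTs.2
  rw [← CFC.rpow_eq_cfc_real (hm'.trans hTm)] at key
  have hcongr : ∀ᶠ i in l, cfc (fun u : ℝ => u ^ r) (f i) = f i ^ r := by
    filter_upwards [hfm] with i hi using (CFC.rpow_eq_cfc_real (hm'.trans hi)).symm
  exact ⟨by
    obtain ⟨d, hd⟩ := key.bounded
    exact ⟨d, by filter_upwards [hd, hcongr] with i h1 h2 using h2 ▸ h1⟩, fun x =>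
    (key.tendsto x).congr' (hcongr.mono fun i hi => by simp only [hi])⟩

theorem geomMeanFormula [l.NeBot] {α : ℝ} (hα₀ : 0 ≤ α) (hf : BoundedStrongTendsto f l S)
    (hg : BoundedStrongTendsto g l T) {m : ℝ} (hm : 0 < m)
    (hfm : ∀ᶠ i in l, algebraMap ℝ (H →L[ℂ] H) m ≤ f i) (hg0 : ∀ᶠ i in l, 0 ≤ g i) :
    BoundedStrongTendsto (fun i => _root_.geomMeanFormula α (f i) (g i)) l
      (_root_.geomMeanFormula α S T) := by
  have h1 := hf.rpow (r := 1 / 2) hm.le (.inl hm) hfm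
  have h2 := hf.rpow (r := -(1 / 2)) hm.le (.inl hm) hfm
  refine (h1.mul (((h2.mul hg).mul h2).rpow le_rfl (.inr hα₀) ?_)).mul h1
  filter_upwards [hg0] with i hi
  rw [map_zero]
  exact (isSelfAdjoint_rpow _ _).conjugate_nonneg hi

end BoundedStrongTendsto

/-- For positive `S`, the norm of `S x` is controlled by the quadratic form of `S` at `x`. -/
theorem norm_apply_sq_le {S : H →L[ℂ] H} (hS : 0 ≤ S) (x : H) :
    ‖S x‖ ^ 2 ≤ ‖S‖ * S.reApplyInnerSelf x := by
  set R := CFC.sqrt S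
  have hRR : R * R = S := CFC.sqrt_mul_sqrt_self S hS
  have hRsa : IsSelfAdjoint R := .of_nonneg (CFC.sqrt_nonneg S)
  have hnorm : ‖S‖ = ‖R‖ * ‖R‖ := by
    have := CStarRing.norm_self_mul_star (x := R)
    rwa [hRsa.star_eq, hRR] at this
  have h1 : S x = R (R x) := by rw [← hRR]; rfl
  have h2 : S.reApplyInnerSelf x = ‖R x‖ ^ 2 := by
    have := hRsa.isSymmetric (R x) x
    simp only [ContinuousLinearMap.coe_coe] at this
    rw [ContinuousLinearMap.reApplyInnerSelf_apply, h1, this, inner_self_eq_norm_sq]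
  have h3 := R.le_opNorm (R x)
  rw [h2, h1, hnorm]
  calc ‖R (R x)‖ ^ 2 ≤ (‖R‖ * ‖R x‖) ^ 2 := by gcongr
    _ = _ := by ring

/-- Vigier's theorem: a family of positive operators that decreases as `ε ↓ 0` converges strongly. The
quadratic forms converge by monotonicity, and `norm_apply_sq_le` turns this into the Cauchy property
for `ε ↦ F ε x`. -/
theorem exists_boundedStrongTendsto_of_monotoneOn {F : ℝ → H →L[ℂ] H}
    (hF0 : ∀ ε, 0 < ε → 0 ≤ F ε) (hmono : ∀ ε δ, 0 < ε → ε ≤ δ → F ε ≤ F δ) :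
    ∃ T, BoundedStrongTendsto F (𝓝[>] 0) T := by
  have hsmall : ∀ᶠ ε : ℝ in 𝓝[>] 0, 0 < ε ∧ ε ≤ 1 := by
    filter_upwards [Ioc_mem_nhdsGT (zero_lt_one (α := ℝ))] with ε h using h
  have hbd : ∀ ε, 0 < ε ∧ ε ≤ 1 → ‖F ε‖ ≤ ‖F 1‖ := fun ε h =>
    CStarAlgebra.norm_le_norm_of_nonneg_of_le (hF0 ε h.1) (hmono ε 1 h.1 h.2)
  have hdiff : ∀ x ε δ, 0 < ε → ε ≤ δ → δ ≤ 1 →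
      ‖F δ x - F ε x‖ ^ 2 ≤ ‖F 1‖ * ((F δ).reApplyInnerSelf x - (F ε).reApplyInnerSelf x) :=
    fun x ε δ h0 h1 h2 => by
      have hd : 0 ≤ F δ - F ε := sub_nonneg.2 (hmono ε δ h0 h1)
      have h3 := norm_apply_sq_le hd x
      have h4 : ‖F δ - F ε‖ ≤ ‖F 1‖ := CStarAlgebra.norm_le_norm_of_nonneg_of_le hd
        ((sub_le_self _ (hF0 ε h0)).trans (hmono δ 1 (h0.trans_le h1) h2))
      have h5 : (F δ - F ε).reApplyInnerSelf x =
          (F δ).reApplyInnerSelf x - (F ε).reApplyInnerSelf x := by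
        simp [ContinuousLinearMap.reApplyInnerSelf_apply, inner_sub_left]
      have h6 := reApplyInnerSelf_nonneg hd x
      rw [h5] at h3 h6
      exact h3.trans (mul_le_mul_of_nonneg_right h4 h6)
  have hconv : ∀ x, ∃ y, Tendsto (fun ε => F ε x) (𝓝[>] 0) (𝓝 y) := fun x => by
    rw [← cauchy_map_iff_exists_tendsto, Metric.cauchy_iff]
    refine ⟨inferInstance, fun η hη => ?_⟩
    have hg : MonotoneOn (fun ε => (F ε).reApplyInnerSelf x) (Set.Ioi 0) :=
      fun ε hε δ _ h => reApplyInnerSelf_mono (hmono ε δ hε h) x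
    have hlim := hg.tendsto_nhdsGT ⟨0, by
      rintro _ ⟨ε, hε, rfl⟩
      exact reApplyInnerSelf_nonneg (hF0 ε hε) x⟩
    obtain ⟨-, hc⟩ := Metric.cauchy_iff.1 hlim.cauchy_map
    obtain ⟨t, ht, htd⟩ := hc (η ^ 2 / (‖F 1‖ + 1)) (by positivity)
    have hs : ∀ᶠ ε in 𝓝[>] 0, (F ε).reApplyInnerSelf x ∈ t ∧ 0 < ε ∧ ε ≤ 1 := by
      filter_upwards [ht, hsmall] with ε h1 h2 using ⟨h1, h2⟩
    have hlt : ∀ ε δ, ((F ε).reApplyInnerSelf x ∈ t ∧ 0 < ε ∧ ε ≤ 1) →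
        ((F δ).reApplyInnerSelf x ∈ t ∧ 0 < δ ∧ δ ≤ 1) → ε ≤ δ → ‖F δ x - F ε x‖ < η :=
      fun ε δ h1 h2 hle => by
        have h3 := hdiff x ε δ h1.2.1 hle h2.2.2
        have h4 := htd _ h2.1 _ h1.1
        rw [Real.dist_eq, lt_div_iff₀ (by positivity)] at h4
        have h5 := le_abs_self ((F δ).reApplyInnerSelf x - (F ε).reApplyInnerSelf x)
        have h6 := abs_nonneg ((F δ).reApplyInnerSelf x - (F ε).reApplyInnerSelf x)
        refine lt_of_pow_lt_pow_left₀ 2 hη.le ?_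
        nlinarith [norm_nonneg (F 1)]
    refine ⟨(fun ε => F ε x) '' _, image_mem_map hs, ?_⟩
    rintro _ ⟨ε, hε, rfl⟩ _ ⟨δ, hδ, rfl⟩
    rcases le_total ε δ with h | h
    · rw [dist_comm, dist_eq_norm]
      exact hlt ε δ hε hδ h
    · rw [dist_eq_norm]
      exact hlt δ ε hδ hε h
  choose y hy using hconv
  exact ⟨continuousLinearMapOfTendsto F (tendsto_pi_nhds.2 hy), ⟨‖F 1‖, hsmall.mono hbd⟩, hy⟩

end Strong

/-! ### Weighted geometric means of positive operators -/

section GeomMean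

variable {H : Type*} [NormedAddCommGroup H] [InnerProductSpace ℂ H] [CompleteSpace H]
variable {K : Type*} [NormedAddCommGroup K] [InnerProductSpace ℂ K] [CompleteSpace K]

omit [CompleteSpace H] in
theorem ofReal_smul_one_eq_algebraMap (ε : ℝ) :
    (ε : ℂ) • (1 : H →L[ℂ] H) = algebraMap ℝ (H →L[ℂ] H) ε := by
  rw [Complex.coe_smul, Algebra.algebraMap_eq_smul_one]

theorem ofReal_smul_one_mono {ε δ : ℝ} (h : ε ≤ δ) :
    (ε : ℂ) • (1 : H →L[ℂ] H) ≤ (δ : ℂ) • 1 := by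
  rw [Complex.coe_smul, Complex.coe_smul]
  exact smul_le_smul_of_nonneg_right h zero_le_one

theorem ofReal_smul_one_nonneg {ε : ℝ} (h : 0 ≤ ε) : (0 : H →L[ℂ] H) ≤ (ε : ℂ) • 1 := by
  simpa using ofReal_smul_one_mono (H := H) h

theorem isStrictlyPositive_add_smul_one {A : H →L[ℂ] H} (hA : 0 ≤ A) {ε : ℝ} (hε : 0 < ε) :
    IsStrictlyPositive (A + (ε : ℂ) • (1 : H →L[ℂ] H)) := by
  rw [ofReal_smul_one_eq_algebraMap]
  exact isStrictlyPositive_add (.inr ⟨hA, isStrictlyPositive_algebraMap hε⟩)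

theorem boundedStrongTendsto_add_smul_one (A : H →L[ℂ] H) :
    BoundedStrongTendsto (fun ε : ℝ => A + (ε : ℂ) • (1 : H →L[ℂ] H)) (𝓝[>] 0) A := by
  have : Continuous (fun ε : ℝ => A + (ε : ℂ) • (1 : H →L[ℂ] H)) := by fun_prop
  have h := this.tendsto 0
  simp only [Complex.ofReal_zero, zero_smul, add_zero] at h
  exact .of_tendsto (h.mono_left nhdsWithin_le_nhds)

theorem eventually_pos_nhdsGT : ∀ᶠ ε : ℝ in 𝓝[>] 0, 0 < ε := self_mem_nhdsWithin

variable {α : ℝ}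

theorem geomMeanFormula_add_smul_one_mono (hα₀ : 0 ≤ α) (hα₁ : α ≤ 1) {A B : H →L[ℂ] H}
    (hA : 0 ≤ A) (hB : 0 ≤ B) {ε δ : ℝ} (hε : 0 < ε) (h : ε ≤ δ) :
    geomMeanFormula α (A + (ε : ℂ) • 1) (B + (ε : ℂ) • 1) ≤
      geomMeanFormula α (A + (δ : ℂ) • 1) (B + (δ : ℂ) • 1) :=
  geomMeanFormula_mono hα₀ hα₁ (isStrictlyPositive_add_smul_one hA hε)
    (isStrictlyPositive_add_smul_one hB hε).nonneg
    (isStrictlyPositive_add_smul_one hA (hε.trans_le h))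
    (add_le_add_right (ofReal_smul_one_mono h) _) (add_le_add_right (ofReal_smul_one_mono h) _)

/-- The limit that defines the mean of positive operators exists. -/
theorem boundedStrongTendsto_geomMean (hα₀ : 0 ≤ α) (hα₁ : α ≤ 1) {A B : H →L[ℂ] H}
    (hA : 0 ≤ A) (hB : 0 ≤ B) :
    BoundedStrongTendsto
      (fun ε : ℝ => geomMeanFormula α (A + (ε : ℂ) • 1) (B + (ε : ℂ) • 1)) (𝓝[>] 0)
      (geomMean α A B) := by
  obtain ⟨T, hT⟩ := exists_boundedStrongTendsto_of_monotoneOn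
    (F := fun ε : ℝ => geomMeanFormula α (A + (ε : ℂ) • 1) (B + (ε : ℂ) • 1))
    (fun ε _ => geomMeanFormula_nonneg _ _ _)
    (fun ε δ hε h => geomMeanFormula_add_smul_one_mono hα₀ hα₁ hA hB hε h)
  have hG : IsGeomMean α A B T := hT.tendsto
  rwa [hG.geomMean_eq]

theorem geomMean_nonneg (hα₀ : 0 ≤ α) (hα₁ : α ≤ 1) {A B : H →L[ℂ] H} (hA : 0 ≤ A) (hB : 0 ≤ B) :
    0 ≤ geomMean α A B :=
  le_of_tendsto_apply (l := 𝓝[>] (0 : ℝ)) (fun _ => tendsto_const_nhds)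
    (boundedStrongTendsto_geomMean hα₀ hα₁ hA hB).tendsto
    (.of_forall fun _ => geomMeanFormula_nonneg _ _ _)

theorem geomMean_le_formula (hα₀ : 0 ≤ α) (hα₁ : α ≤ 1) {A B : H →L[ℂ] H}
    (hA : 0 ≤ A) (hB : 0 ≤ B) {δ : ℝ} (hδ : 0 < δ) :
    geomMean α A B ≤ geomMeanFormula α (A + (δ : ℂ) • 1) (B + (δ : ℂ) • 1) := by
  refine le_of_tendsto_apply (boundedStrongTendsto_geomMean hα₀ hα₁ hA hB).tendsto
    (fun _ => tendsto_const_nhds) ?_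
  filter_upwards [Ioc_mem_nhdsGT hδ] with ε hε
  exact geomMeanFormula_add_smul_one_mono hα₀ hα₁ hA hB hε.1 hε.2

theorem le_geomMean (hα₀ : 0 ≤ α) (hα₁ : α ≤ 1) {A B T : H →L[ℂ] H} (hA : 0 ≤ A) (hB : 0 ≤ B)
    (h : ∀ ε : ℝ, 0 < ε → T ≤ geomMeanFormula α (A + (ε : ℂ) • 1) (B + (ε : ℂ) • 1)) :
    T ≤ geomMean α A B :=
  le_of_tendsto_apply (l := 𝓝[>] (0 : ℝ)) (fun _ => tendsto_const_nhds)
    (boundedStrongTendsto_geomMean hα₀ hα₁ hA hB).tendsto (eventually_pos_nhdsGT.mono h)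

/-- Ando's inequality for a finite family of positive maps and arbitrary positive operators. -/
theorem sum_map_geomMean_le {ι : Type*} [Fintype ι]
    (Φ : ι → (H →L[ℂ] H) →ₗ[ℂ] (K →L[ℂ] K)) (hΦ : ∀ j X, 0 ≤ X → 0 ≤ Φ j X)
    (hα₀ : 0 ≤ α) (hα₁ : α ≤ 1) {A B : ι → H →L[ℂ] H} {C D : K →L[ℂ] K}
    (hA : ∀ j, 0 ≤ A j) (hB : ∀ j, 0 ≤ B j) (hAC : ∑ j, Φ j (A j) ≤ C)
    (hBD : ∑ j, Φ j (B j) ≤ D) :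
    ∑ j, Φ j (geomMean α (A j) (B j)) ≤ geomMean α C D := by
  have hC : 0 ≤ C := (Finset.sum_nonneg fun j _ => hΦ j _ (hA j)).trans hAC
  have hD : 0 ≤ D := (Finset.sum_nonneg fun j _ => hΦ j _ (hB j)).trans hBD
  refine le_geomMean hα₀ hα₁ hC hD fun ε hε => ?_
  -- `Φ` need not be strongly continuous, so `A` and `B` are perturbed by a `δ` for which
  -- `δ ∑ Φ_j(1) ≤ ε`
  set U := ∑ j, Φ j 1
  have hU0 : 0 ≤ U := Finset.sum_nonneg fun j _ => hΦ j _ zero_le_one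
  set δ : ℝ := ε / (‖U‖ + 1) with hδdef
  have hδ : 0 < δ := by positivity
  have hδU : (δ : ℂ) • U ≤ (ε : ℂ) • 1 := by
    have h1 : U ≤ algebraMap ℝ _ ‖U‖ := (IsSelfAdjoint.of_nonneg hU0).le_algebraMap_norm_self
    rw [Algebra.algebraMap_eq_smul_one] at h1
    rw [Complex.coe_smul, Complex.coe_smul]
    refine (smul_le_smul_of_nonneg_left h1 hδ.le).trans ?_
    rw [smul_smul]
    refine smul_le_smul_of_nonneg_right ?_ zero_le_one
    rw [hδdef, div_mul_eq_mul_div, div_le_iff₀ (by positivity)]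
    nlinarith
  have hshift : ∀ (X : ι → H →L[ℂ] H) (Y : K →L[ℂ] K), ∑ j, Φ j (X j) ≤ Y →
      ∑ j, Φ j (X j + (δ : ℂ) • 1) ≤ Y + (ε : ℂ) • 1 := fun X Y h => by
    simp only [map_add, map_smul, Finset.sum_add_distrib, ← Finset.smul_sum]
    exact add_le_add h hδU
  refine le_trans (Finset.sum_le_sum fun j _ => ?_) (sum_map_geomMeanFormula_le Φ hΦ hα₀ hα₁
    (fun j => isStrictlyPositive_add_smul_one (hA j) hδ)
    (fun j => (isStrictlyPositive_add_smul_one (hB j) hδ).nonneg)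
    (isStrictlyPositive_add_smul_one hC hε) (hshift A C hAC) (hshift B D hBD))
  rw [← sub_nonneg, ← map_sub]
  exact hΦ j _ (sub_nonneg.2 (geomMean_le_formula hα₀ hα₁ (hA j) (hB j) hδ))

theorem geomMean_mono (hα₀ : 0 ≤ α) (hα₁ : α ≤ 1) {A B C D : H →L[ℂ] H}
    (hA : 0 ≤ A) (hB : 0 ≤ B) (hAC : A ≤ C) (hBD : B ≤ D) : geomMean α A B ≤ geomMean α C D := by
  simpa using sum_map_geomMean_le (fun _ : Unit => LinearMap.id) (fun _ _ h => h) hα₀ hα₁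
    (A := fun _ => A) (B := fun _ => B) (fun _ => hA) (fun _ => hB) (C := C) (D := D)
    (by simpa) (by simpa)

/-- Upper semicontinuity of the mean under bounded strong convergence. The inequality
`f i ♯_α g i ≤ (f i + ε) ♯_α (g i + ε)` makes room for a fixed `ε`, for which the mean is strongly
continuous. -/
theorem le_geomMean_of_boundedStrongTendsto (hα₀ : 0 ≤ α) (hα₁ : α ≤ 1) {ι : Type*}
    {l : Filter ι} [l.NeBot] {f g h : ι → H →L[ℂ] H} {A B T : H →L[ℂ] H}
    (hf : BoundedStrongTendsto f l A) (hg : BoundedStrongTendsto g l B)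
    (hh : BoundedStrongTendsto h l T) (hfpos : ∀ᶠ i in l, IsStrictlyPositive (f i))
    (hgpos : ∀ᶠ i in l, 0 ≤ g i) (hle : ∀ᶠ i in l, h i ≤ geomMeanFormula α (f i) (g i)) :
    T ≤ geomMean α A B := by
  have hA : 0 ≤ A := le_of_tendsto_apply (fun _ => tendsto_const_nhds) hf.tendsto
    (hfpos.mono fun _ hi => hi.nonneg)
  have hB : 0 ≤ B := le_of_tendsto_apply (fun _ => tendsto_const_nhds) hg.tendsto hgpos
  refine le_geomMean hα₀ hα₁ hA hB fun ε hε => ?_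
  have hlim := (hf.add (.const ((ε : ℂ) • 1))).geomMeanFormula hα₀
    (hg.add (.const ((ε : ℂ) • 1))) hε
    (by
      filter_upwards [hfpos] with i hi
      rw [ofReal_smul_one_eq_algebraMap]
      exact le_add_of_nonneg_left hi.nonneg)
    (hgpos.mono fun i hi => add_nonneg hi (ofReal_smul_one_nonneg hε.le))
  refine le_of_tendsto_apply hh.tendsto hlim.tendsto ?_
  filter_upwards [hfpos, hgpos, hle] with i h1 h2 h3
  exact h3.trans (geomMeanFormula_mono hα₀ hα₁ h1 h2 (isStrictlyPositive_add_smul_one h1.nonneg hε)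
    (le_add_of_nonneg_right (ofReal_smul_one_nonneg hε.le))
    (le_add_of_nonneg_right (ofReal_smul_one_nonneg hε.le)))

/-- One half of the identity `(M ♯_β A) ♯_α (M ♯_β B) = M` for `M = A ♯_α B`. It follows from
monotonicity: the left-hand side is at most its value at `A + ε` and `B + ε`, where the identity is
known. -/
theorem geomMean_refine_le {β : ℝ} (hα₀ : 0 ≤ α) (hα₁ : α ≤ 1) (hβ₀ : 0 ≤ β) (hβ₁ : β ≤ 1)
    {A B : H →L[ℂ] H} (hA : 0 ≤ A) (hB : 0 ≤ B) :
    geomMean α (geomMean β (geomMean α A B) A) (geomMean β (geomMean α A B) B) ≤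
      geomMean α A B := by
  have hM := geomMean_nonneg hα₀ hα₁ hA hB
  refine le_geomMean hα₀ hα₁ hA hB fun ε hε => ?_
  have hA' := isStrictlyPositive_add_smul_one hA hε
  have hB' := isStrictlyPositive_add_smul_one hB hε
  have hM' := isStrictlyPositive_geomMeanFormula α hA' hB'
  have hMle := geomMean_le_formula hα₀ hα₁ hA hB hε
  have hle : ∀ X : H →L[ℂ] H, 0 ≤ X → geomMean β (geomMean α A B) X ≤
      geomMeanFormula β (geomMeanFormula α (A + (ε : ℂ) • 1) (B + (ε : ℂ) • 1))
        (X + (ε : ℂ) • 1) := fun X hX => by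
    rw [← geomMean_eq_formula hβ₀ hM' (isStrictlyPositive_add_smul_one hX hε).nonneg]
    exact geomMean_mono hβ₀ hβ₁ hM hX hMle (le_add_of_nonneg_right (ofReal_smul_one_nonneg hε.le))
  refine (geomMean_mono hα₀ hα₁ (geomMean_nonneg hβ₀ hβ₁ hM hA) (geomMean_nonneg hβ₀ hβ₁ hM hB)
    (hle A hA) (hle B hB)).trans (le_of_eq ?_)
  rw [geomMean_eq_formula hα₀ (isStrictlyPositive_geomMeanFormula β hM' hA')
    (geomMeanFormula_nonneg _ _ _), geomMeanFormula_refine hα₀ hα₁ hβ₀ hβ₁ hA' hB']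

/-- The other half of the identity `(M ♯_β A) ♯_α (M ♯_β B) = M` for `M = A ♯_α B`. The identity is
known for the perturbed means `M_ε`, which converge to `M` only strongly, so the limit is taken with
upper semicontinuity, once for the inner means and once for the outer one. -/
theorem le_geomMean_refine {β : ℝ} (hα₀ : 0 ≤ α) (hα₁ : α ≤ 1) (hβ₀ : 0 ≤ β) (hβ₁ : β ≤ 1)
    {A B : H →L[ℂ] H} (hA : 0 ≤ A) (hB : 0 ≤ B) :
    geomMean α A B ≤
      geomMean α (geomMean β (geomMean α A B) A) (geomMean β (geomMean α A B) B) := by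
  have hA' : ∀ ε : ℝ, 0 < ε → IsStrictlyPositive (A + (ε : ℂ) • (1 : H →L[ℂ] H)) :=
    fun _ => isStrictlyPositive_add_smul_one hA
  have hB' : ∀ ε : ℝ, 0 < ε → IsStrictlyPositive (B + (ε : ℂ) • (1 : H →L[ℂ] H)) :=
    fun _ => isStrictlyPositive_add_smul_one hB
  set M : ℝ → H →L[ℂ] H := fun ε => geomMeanFormula α (A + (ε : ℂ) • 1) (B + (ε : ℂ) • 1)
  have hM : ∀ ε, 0 < ε → IsStrictlyPositive (M ε) := fun ε hε =>
    isStrictlyPositive_geomMeanFormula α (hA' ε hε) (hB' ε hε)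
  have hMlim : BoundedStrongTendsto M (𝓝[>] 0) (geomMean α A B) :=
    boundedStrongTendsto_geomMean hα₀ hα₁ hA hB
  have hMnonneg := geomMean_nonneg hα₀ hα₁ hA hB
  have hlim : ∀ X : H →L[ℂ] H, 0 ≤ X → ∃ T, 0 ≤ T ∧ T ≤ geomMean β (geomMean α A B) X ∧
      BoundedStrongTendsto (fun ε : ℝ => geomMeanFormula β (M ε) (X + (ε : ℂ) • 1)) (𝓝[>] 0) T :=
    fun X hX => by
      have hX' : ∀ ε : ℝ, 0 < ε → IsStrictlyPositive (X + (ε : ℂ) • (1 : H →L[ℂ] H)) :=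
        fun _ => isStrictlyPositive_add_smul_one hX
      obtain ⟨T, hT⟩ := exists_boundedStrongTendsto_of_monotoneOn
        (F := fun ε : ℝ => geomMeanFormula β (M ε) (X + (ε : ℂ) • 1))
        (fun _ _ => geomMeanFormula_nonneg _ _ _)
        (fun ε δ hε h => geomMeanFormula_mono hβ₀ hβ₁ (hM ε hε) (hX' ε hε).nonneg
          (hM δ (hε.trans_le h)) (geomMeanFormula_add_smul_one_mono hα₀ hα₁ hA hB hε h)
          (add_le_add_right (ofReal_smul_one_mono h) _))
      refine ⟨T, ?_, ?_, hT⟩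
      · exact le_of_tendsto_apply (fun _ => tendsto_const_nhds) hT.tendsto
          (.of_forall fun _ => geomMeanFormula_nonneg _ _ _)
      · exact le_geomMean_of_boundedStrongTendsto hβ₀ hβ₁ hMlim
          (boundedStrongTendsto_add_smul_one X) hT (eventually_pos_nhdsGT.mono hM)
          (eventually_pos_nhdsGT.mono fun ε hε => (hX' ε hε).nonneg) (.of_forall fun _ => le_rfl)
  obtain ⟨S, hS0, hSle, hS⟩ := hlim A hA
  obtain ⟨T, hT0, hTle, hT⟩ := hlim B hB
  refine le_trans ?_ (geomMean_mono hα₀ hα₁ hS0 hT0 hSle hTle)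
  refine le_geomMean_of_boundedStrongTendsto hα₀ hα₁ hS hT hMlim ?_
    (.of_forall fun _ => geomMeanFormula_nonneg _ _ _) ?_
  · filter_upwards [eventually_pos_nhdsGT] with ε hε
    exact isStrictlyPositive_geomMeanFormula β (hM ε hε) (hA' ε hε)
  · filter_upwards [eventually_pos_nhdsGT] with ε hε
    exact (geomMeanFormula_refine hα₀ hα₁ hβ₀ hβ₁ (hA' ε hε) (hB' ε hε)).ge

/-- The refined Ando inequality for a finite family of positive maps; one map, and copies of the
identity, are the two cases of interest. -/
theorem sum_map_geomMean_refine {ι : Type*} [Fintype ι]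
    (Φ : ι → (H →L[ℂ] H) →ₗ[ℂ] (K →L[ℂ] K)) (hΦ : ∀ j X, 0 ≤ X → 0 ≤ Φ j X) {β : ℝ}
    (hα₀ : 0 ≤ α) (hα₁ : α ≤ 1) (hβ₀ : 0 ≤ β) (hβ₁ : β ≤ 1) {A B : ι → H →L[ℂ] H}
    (hA : ∀ j, 0 ≤ A j) (hB : ∀ j, 0 ≤ B j) :
    ∑ j, Φ j (geomMean α (A j) (B j)) ≤
        geomMean α (∑ j, Φ j (geomMean β (geomMean α (A j) (B j)) (A j)))
          (∑ j, Φ j (geomMean β (geomMean α (A j) (B j)) (B j))) ∧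
      geomMean α (∑ j, Φ j (geomMean β (geomMean α (A j) (B j)) (A j)))
          (∑ j, Φ j (geomMean β (geomMean α (A j) (B j)) (B j))) ≤
        geomMean α (∑ j, Φ j (A j)) (∑ j, Φ j (B j)) := by
  have hM : ∀ j, 0 ≤ geomMean α (A j) (B j) := fun j => geomMean_nonneg hα₀ hα₁ (hA j) (hB j)
  have hMA : ∀ j, 0 ≤ geomMean β (geomMean α (A j) (B j)) (A j) := fun j =>
    geomMean_nonneg hβ₀ hβ₁ (hM j) (hA j)
  have hMB : ∀ j, 0 ≤ geomMean β (geomMean α (A j) (B j)) (B j) := fun j =>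
    geomMean_nonneg hβ₀ hβ₁ (hM j) (hB j)
  constructor
  · refine le_trans (Finset.sum_le_sum fun j _ => ?_)
      (sum_map_geomMean_le Φ hΦ hα₀ hα₁ hMA hMB le_rfl le_rfl)
    rw [← sub_nonneg, ← map_sub]
    exact hΦ j _ (sub_nonneg.2 (le_geomMean_refine hα₀ hα₁ hβ₀ hβ₁ (hA j) (hB j)))
  · have hle := sum_map_geomMean_le Φ hΦ hα₀ hα₁ hA hB le_rfl le_rfl
    refine (geomMean_mono hα₀ hα₁ (Finset.sum_nonneg fun j _ => hΦ j _ (hMA j))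
      (Finset.sum_nonneg fun j _ => hΦ j _ (hMB j))
      (sum_map_geomMean_le Φ hΦ hβ₀ hβ₁ hM hA hle le_rfl)
      (sum_map_geomMean_le Φ hΦ hβ₀ hβ₁ hM hB hle le_rfl)).trans ?_
    exact geomMean_refine_le hα₀ hα₁ hβ₀ hβ₁ (Finset.sum_nonneg fun j _ => hΦ j _ (hA j))
      (Finset.sum_nonneg fun j _ => hΦ j _ (hB j))

end GeomMean

theorem theorem3p1
    {H : Type*} [NormedAddCommGroup H] [InnerProductSpace ℂ H] [CompleteSpace H]
    {K : Type*} [NormedAddCommGroup K] [InnerProductSpace ℂ K] [CompleteSpace K]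
    (α β : ℝ) (hα₀ : 0 ≤ α) (hα₁ : α ≤ 1) (hβ₀ : 0 ≤ β) (hβ₁ : β ≤ 1) :
    -- the weighted geometric means of positive operators exist
    (∀ γ : ℝ, 0 ≤ γ → γ ≤ 1 →
      (∀ A B : H →L[ℂ] H, 0 ≤ A → 0 ≤ B → IsGeomMean γ A B (geomMean γ A B)) ∧
      (∀ A B : K →L[ℂ] K, 0 ≤ A → 0 ≤ B → IsGeomMean γ A B (geomMean γ A B))) ∧
    -- the refined inequality for a positive linear map
    (∀ Φ : (H →L[ℂ] H) →ₗ[ℂ] (K →L[ℂ] K), (∀ X : H →L[ℂ] H, 0 ≤ X → 0 ≤ Φ X) →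
      ∀ A B : H →L[ℂ] H, 0 ≤ A → 0 ≤ B →
        Φ (geomMean α A B) ≤
          geomMean α (Φ (geomMean β (geomMean α A B) A)) (Φ (geomMean β (geomMean α A B) B)) ∧
        geomMean α (Φ (geomMean β (geomMean α A B) A)) (Φ (geomMean β (geomMean α A B) B)) ≤
          geomMean α (Φ A) (Φ B)) ∧
    -- the refined inequality for sums
    (∀ (m : ℕ) (A B : Fin m → H →L[ℂ] H), (∀ j, 0 ≤ A j) → (∀ j, 0 ≤ B j) →
      ∑ j, geomMean α (A j) (B j) ≤
        geomMean α (∑ j, geomMean β (geomMean α (A j) (B j)) (A j))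
          (∑ j, geomMean β (geomMean α (A j) (B j)) (B j)) ∧
      geomMean α (∑ j, geomMean β (geomMean α (A j) (B j)) (A j))
          (∑ j, geomMean β (geomMean α (A j) (B j)) (B j)) ≤
        geomMean α (∑ j, A j) (∑ j, B j)) := by

  refine ⟨fun γ h0 h1 => ⟨fun A B hA hB => (boundedStrongTendsto_geomMean h0 h1 hA hB).tendsto,
    fun A B hA hB => (boundedStrongTendsto_geomMean h0 h1 hA hB).tendsto⟩,
    fun Φ hΦ A B hA hB => ?_, fun m A B hA hB => ?_⟩
  · simpa using sum_map_geomMean_refine (fun _ : Unit => Φ) (fun _ => hΦ) hα₀ hα₁ hβ₀ hβ₁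
      (A := fun _ => A) (B := fun _ => B) (fun _ => hA) (fun _ => hB)
  · exact sum_map_geomMean_refine (fun _ => LinearMap.id) (fun _ _ h => h) hα₀ hα₁ hβ₀ hβ₁ hA hB
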